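/- Let $X$ be a real Banach space with a Schauder basis $(e_i)_{i\ge 1}$ that is $1$-suppression unconditional, i.e. $\big\|\sum_{i\in F} c_i e_i\big\| \le \big\|\sum_{i=1}^n c_i e_i\big\|$ for all $n\in\mathbb{N}$, all real scalars $c_1,\dots,c_n$ and all $F\subset\{1,\dots,n\}$. Call a basic sequence in $X$ a $\mathrm{c}_0$-sequence if it is equivalent to the unit vector basis of $\mathrm{c}_0$. Say that $X$ has the $(N_k1)$ property if for some integer $k\ge 1$ there are a $\mathrm{c}_0$-sequence $(x_n)_{n\ge1}$ in $X$ and a sequence $(\alpha_n)$ in $[0,1)$ converging to $1$ such that \[ \Big\|\sum_{n=k}^\infty \alpha_n a_n x_n\Big\| \le \Big\|\sum_{n=1}^\infty a_n x_n\Big\| \quad\text{for all } (a_n)_{n\ge1}\in \mathrm{c}_0 . \] If $X$ fails the $(N_k1)$ property, then $X$ has the point of continuity property (PCP): for every non-empty norm-closed subset $K$ of the closed unit ball $B_X$, the identity mapping on $K$ is weak-to-norm continuous at some point of $K$. -/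

import Mathlib

open Filter Topology
open scoped ZeroAtInfty

/-- The unit vector basis of the real Banach space `c₀` (sequences tending to zero, with the
supremum norm), realised as `C₀(ℕ, ℝ)`; sequences are indexed from `0`. -/
noncomputable def c0UnitBasis (n : ℕ) : C₀(ℕ, ℝ) where
  toFun := Pi.single n 1
  continuous_toFun := continuous_of_discreteTopology
  zero_at_infty' := by
    rw [Filter.cocompact_eq_cofinite, Nat.cofinite_eq_atTop]
    refine tendsto_const_nhds.congr' ?_
    filter_upwards [eventually_gt_atTop n] with m hm
    rw [Pi.single_eq_of_ne hm.ne']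

/-- A sequence is basic if it is a Schauder basis of its closed linear span. -/
def IsBasicSequence {X : Type*} [NormedAddCommGroup X] [NormedSpace ℝ X] (x : ℕ → X) : Prop :=
  ∃ b : SchauderBasis ℝ (Submodule.span ℝ (Set.range x)).topologicalClosure,
    ∀ n, ((b n : (Submodule.span ℝ (Set.range x)).topologicalClosure) : X) = x n

/-- `(x n)` `C`-dominates `(y n)`. -/
def CDominates {X Y : Type*} [NormedAddCommGroup X] [NormedSpace ℝ X]
    [NormedAddCommGroup Y] [NormedSpace ℝ Y] (C : ℝ) (x : ℕ → X) (y : ℕ → Y) : Prop :=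
  ∀ (n : ℕ) (a : ℕ → ℝ),
    ‖∑ i ∈ Finset.range n, a i • y i‖ ≤ C * ‖∑ i ∈ Finset.range n, a i • x i‖

/-- Equivalence of (basic) sequences: each dominates the other. -/
def EquivalentSequences {X Y : Type*} [NormedAddCommGroup X] [NormedSpace ℝ X]
    [NormedAddCommGroup Y] [NormedSpace ℝ Y] (x : ℕ → X) (y : ℕ → Y) : Prop :=
  (∃ A : ℝ, 1 ≤ A ∧ CDominates A x y) ∧ (∃ B : ℝ, 1 ≤ B ∧ CDominates B y x)

/-- A `c₀`-sequence: a basic sequence equivalent to the unit basis of `c₀`. -/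
def IsC0Sequence {X : Type*} [NormedAddCommGroup X] [NormedSpace ℝ X] (x : ℕ → X) : Prop :=
  IsBasicSequence x ∧ EquivalentSequences x c0UnitBasis

/-- The `(N_k 1)` property of a `c₀`-sequence, for an integer `k ≥ 1`. The entry `x n` is the
`(n + 1)`-st term of the sequence, so that the tail starting at the `k`-th term consists of the
`n` with `k ≤ n + 1`. The convergence of both series (automatic for `c₀`-sequences) is part of
the definition. -/
def SeqHasNk1 {X : Type*} [NormedAddCommGroup X] [NormedSpace ℝ X] (k : ℕ) (x : ℕ → X) : Prop :=
  IsC0Sequence x ∧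
    ∃ α : ℕ → ℝ, (∀ n, α n ∈ Set.Ico (0 : ℝ) 1) ∧ Tendsto α atTop (𝓝 1) ∧
      ∀ a : C₀(ℕ, ℝ), ∃ u v : X,
        HasSum (fun n => if k ≤ n + 1 then (α n * a n) • x n else 0) u
          (SummationFilter.conditional ℕ) ∧
        HasSum (fun n => a n • x n) v (SummationFilter.conditional ℕ) ∧
        ‖u‖ ≤ ‖v‖

/-- The `(N_k 1)` property of a Banach space: some `c₀`-sequence in it has the `(N_k 1)` property
for some integer `k ≥ 1`. -/
def SpaceHasNk1 (X : Type*) [NormedAddCommGroup X] [NormedSpace ℝ X] : Prop :=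
  ∃ k : ℕ, 1 ≤ k ∧ ∃ x : ℕ → X, SeqHasNk1 k x

/-- `β`-suppression unconditionality of a Schauder basis. -/
def IsSuppressionUnconditional {X : Type*} [NormedAddCommGroup X] [NormedSpace ℝ X]
    (β : ℝ) (e : SchauderBasis ℝ X) : Prop :=
  ∀ (n : ℕ) (c : ℕ → ℝ) (F : Finset ℕ), F ⊆ Finset.range n →
    ‖∑ i ∈ F, c i • e i‖ ≤ β * ‖∑ i ∈ Finset.range n, c i • e i‖

/-- The point of continuity property of a (closed, bounded, convex) set `C`: on every nonempty
norm-closed `K ⊆ C` the identity is weak-to-norm continuous at some point of `K`. -/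
def SetHasPCP {X : Type*} [NormedAddCommGroup X] [NormedSpace ℝ X] (C : Set X) : Prop :=
  ∀ K : Set X, K ⊆ C → IsClosed K → K.Nonempty →
    ∃ x ∈ K, ContinuousWithinAt (fun y : WeakSpace ℝ X => (toWeakSpace ℝ X).symm y)
      (toWeakSpace ℝ X '' K) (toWeakSpace ℝ X x)

/-- A space has PCP if its closed unit ball does. -/
def SpaceHasPCP (X : Type*) [NormedAddCommGroup X] [NormedSpace ℝ X] : Prop :=
  SetHasPCP (Metric.closedBall (0 : X) 1)

/-! If PCP fails, some nonempty `K` in the ball and some `ε > 0` are such that every weak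
neighbourhood of every point of `K` contains a point of `K` at distance at least `ε`
(`setHasPCP_of_forall_exists_nhds`). Walk in `K` by such jumps, each barely changing the coordinates
already in use. The increments are then nearly disjoint blocks of the basis, and their sums
telescope, hence stay bounded. Truncating them to blocks gives a suppression unconditional sequence,
bounded away from zero, with bounded partial sums (`IsSuppressionUnconditional.spaceHasNk1`). Such a
sequence is equivalent to the `c₀` basis, and multipliers in `[0, 1]` are contractive on it, so
`(N_1 1)` holds (`IsSuppressionSequence.seqHasNk1`). -/

/-- If a family is bounded on all subsums of a finite set, then so are the combinations with
coefficients in `[0, 1]`. -/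
theorem norm_add_sum_smul_le_of_forall_subset {X ι : Type*} [NormedAddCommGroup X]
    [NormedSpace ℝ X] (y : ι → X) (t : ι → ℝ) (ht : ∀ i, t i ∈ Set.Icc (0 : ℝ) 1) (M : ℝ)
    (s : Finset ι) (w : X) (h : ∀ F ⊆ s, ‖w + ∑ i ∈ F, y i‖ ≤ M) :
    ‖w + ∑ i ∈ s, t i • y i‖ ≤ M := by
  classical
  induction s using Finset.induction_on generalizing w with
  | empty => simpa using h ∅ subset_rfl
  | insert a s ha ih =>
    have h1 := ih w fun F hF => h F (hF.trans (Finset.subset_insert _ _))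
    have h2 := ih (w + y a) fun F hF => by
      have haF : a ∉ F := fun hm => ha (hF hm)
      have := h (insert a F) (Finset.insert_subset_insert _ hF)
      rwa [Finset.sum_insert haF, ← add_assoc] at this
    obtain ⟨h0, h1'⟩ := ht a
    -- The sum is affine in `t a`, so it lies on the segment between the cases `t a = 0` and `t a =
    -- 1`; the latter is absorbed into the shift `w`.
    have hconv := convex_closedBall (0 : X) M (mem_closedBall_zero_iff.2 h1)
      (mem_closedBall_zero_iff.2 h2) (sub_nonneg.2 h1') h0 (sub_add_cancel 1 (t a))
    rw [mem_closedBall_zero_iff] at hconv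
    rw [Finset.sum_insert ha]
    have he : w + (t a • y a + ∑ i ∈ s, t i • y i) =
        (1 - t a) • (w + ∑ i ∈ s, t i • y i) + t a • (w + y a + ∑ i ∈ s, t i • y i) := by
      module
    rwa [he]

/-- A sequence is `1`-suppression unconditional if restricting a finite linear combination to a
subset of the indices does not increase its norm. -/
def IsSuppressionSequence {X : Type*} [NormedAddCommGroup X] [NormedSpace ℝ X] (z : ℕ → X) :
    Prop :=
  ∀ (n : ℕ) (c : ℕ → ℝ) (F : Finset ℕ), F ⊆ Finset.range n →
    ‖∑ i ∈ F, c i • z i‖ ≤ ‖∑ i ∈ Finset.range n, c i • z i‖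

/-! ### Suppression unconditional sequences and `c₀` -/

section SuppressionSequence

variable {X : Type*} [NormedAddCommGroup X] [NormedSpace ℝ X] {z : ℕ → X}

theorem IsSuppressionSequence.norm_sum_mul_le (hz : IsSuppressionSequence z) (t c : ℕ → ℝ)
    (ht : ∀ i, t i ∈ Set.Icc (0 : ℝ) 1) (n : ℕ) :
    ‖∑ i ∈ Finset.range n, (t i * c i) • z i‖ ≤ ‖∑ i ∈ Finset.range n, c i • z i‖ := by
  have := norm_add_sum_smul_le_of_forall_subset (fun i => c i • z i) t ht
    ‖∑ i ∈ Finset.range n, c i • z i‖ (Finset.range n) 0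
    fun F hF => by simpa using hz n c F hF
  simpa [smul_smul] using this

/-- The positive and negative parts of `a` are each `[0, 1]`-multiples of the constant sequence `M`;
the two parts give the factor 2. -/
theorem IsSuppressionSequence.norm_sum_le (hz : IsSuppressionSequence z) {C : ℝ}
    (hC : ∀ n, ‖∑ i ∈ Finset.range n, z i‖ ≤ C) (a : ℕ → ℝ) (M : ℝ) (hM : 0 ≤ M) (n : ℕ)
    (ha : ∀ i < n, |a i| ≤ M) : ‖∑ i ∈ Finset.range n, a i • z i‖ ≤ 2 * C * M := by
  have key : ∀ b : ℕ → ℝ, (∀ i < n, b i ∈ Set.Icc (0 : ℝ) M) →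
      ‖∑ i ∈ Finset.range n, b i • z i‖ ≤ C * M := by
    intro b hb
    rcases hM.eq_or_lt with rfl | hM
    · have h0 : ∑ i ∈ Finset.range n, b i • z i = 0 := Finset.sum_eq_zero fun i hi => by
        have h := hb i (Finset.mem_range.1 hi)
        rw [le_antisymm h.2 h.1, zero_smul]
      simp [h0]
    · have h := hz.norm_sum_mul_le (fun i => if i < n then b i / M else 0) (fun _ => M)
        (fun i => by
          split_ifs with hi
          · exact ⟨div_nonneg (hb i hi).1 hM.le, (div_le_one hM).2 (hb i hi).2⟩
          · simp) n
      rw [← Finset.smul_sum, norm_smul, Real.norm_of_nonneg hM.le, mul_comm M] at h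
      refine le_trans (le_of_eq ?_) (h.trans (mul_le_mul_of_nonneg_right (hC n) hM.le))
      congr 1
      refine Finset.sum_congr rfl fun i hi => ?_
      rw [if_pos (Finset.mem_range.1 hi), div_mul_cancel₀ _ hM.ne']
  have h1 := key (fun i => max (a i) 0) fun i hi =>
    ⟨le_max_right _ _, max_le ((le_abs_self _).trans (ha i hi)) hM⟩
  have h2 := key (fun i => max (-a i) 0) fun i hi =>
    ⟨le_max_right _ _, max_le ((neg_le_abs _).trans (ha i hi)) hM⟩
  have h3 : ∑ i ∈ Finset.range n, a i • z i =
      ∑ i ∈ Finset.range n, max (a i) 0 • z i - ∑ i ∈ Finset.range n, max (-a i) 0 • z i := by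
    rw [← Finset.sum_sub_distrib]
    refine Finset.sum_congr rfl fun i _ => ?_
    rw [← sub_smul]
    congr 1
    rcases le_total (a i) 0 with h | h
    · rw [max_eq_right h, max_eq_left (neg_nonneg.2 h)]; ring
    · rw [max_eq_left h, max_eq_right (neg_nonpos.2 h)]; ring
  rw [h3]
  exact (norm_sub_le _ _).trans (by linarith)

theorem IsSuppressionSequence.mul_abs_le (hz : IsSuppressionSequence z) {η : ℝ}
    (hη : ∀ n, η ≤ ‖z n‖) (a : ℕ → ℝ) {n j : ℕ} (hj : j < n) :
    η * |a j| ≤ ‖∑ i ∈ Finset.range n, a i • z i‖ := by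
  have h := hz n a {j} (by simpa using hj)
  rw [Finset.sum_singleton, norm_smul, Real.norm_eq_abs] at h
  nlinarith [hη j, abs_nonneg (a j)]

theorem sum_c0UnitBasis_apply (a : ℕ → ℝ) (n j : ℕ) :
    (∑ i ∈ Finset.range n, a i • c0UnitBasis i) j = if j < n then a j else 0 := by
  have hb : ∀ i, c0UnitBasis i j = if j = i then 1 else 0 := fun i => Pi.single_apply i 1 j
  induction n with
  | zero => simp
  | succ n ih =>
    rw [Finset.sum_range_succ, ZeroAtInftyContinuousMap.add_apply, ih,
      ZeroAtInftyContinuousMap.smul_apply, hb]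
    rcases lt_trichotomy j n with h | rfl | h
    · simp [h, h.ne, h.trans n.lt_succ_self]
    · simp
    · simp [h.ne', h.not_gt, (Nat.succ_le_of_lt h).not_gt]

theorem abs_le_norm_sum_c0UnitBasis (a : ℕ → ℝ) {n j : ℕ} (hj : j < n) :
    |a j| ≤ ‖∑ i ∈ Finset.range n, a i • c0UnitBasis i‖ := by
  have h := (∑ i ∈ Finset.range n, a i • c0UnitBasis i).toBCF.norm_coe_le_norm j
  have h2 := (sum_c0UnitBasis_apply a n j).trans (if_pos hj)
  rw [ZeroAtInftyContinuousMap.norm_toBCF_eq_norm] at h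
  exact (congrArg abs h2).symm.le.trans h

theorem norm_sum_c0UnitBasis_le (a : ℕ → ℝ) {n : ℕ} {M : ℝ} (hM : 0 ≤ M)
    (ha : ∀ i < n, |a i| ≤ M) : ‖∑ i ∈ Finset.range n, a i • c0UnitBasis i‖ ≤ M := by
  rw [← ZeroAtInftyContinuousMap.norm_toBCF_eq_norm, BoundedContinuousFunction.norm_le hM]
  intro j
  refine (congrArg abs (sum_c0UnitBasis_apply a n j)).le.trans ?_
  split_ifs with h
  · exact ha j h
  · simpa using hM

theorem IsSuppressionSequence.equivalent_c0UnitBasis (hz : IsSuppressionSequence z) {C η : ℝ}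
    (hC : ∀ n, ‖∑ i ∈ Finset.range n, z i‖ ≤ C) (hη0 : 0 < η) (hη : ∀ n, η ≤ ‖z n‖) :
    EquivalentSequences z c0UnitBasis := by
  refine ⟨⟨max 1 η⁻¹, le_max_left _ _, fun n a => ?_⟩, ⟨max 1 (2 * C), le_max_left _ _,
    fun n a => ?_⟩⟩
  · refine le_trans ?_ (mul_le_mul_of_nonneg_right (le_max_right _ _) (norm_nonneg _))
    refine norm_sum_c0UnitBasis_le a (by positivity) fun i hi => ?_
    rw [inv_mul_eq_div, le_div_iff₀ hη0, mul_comm]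
    exact hz.mul_abs_le hη a hi
  · refine le_trans ?_ (mul_le_mul_of_nonneg_right (le_max_right _ _) (norm_nonneg _))
    exact hz.norm_sum_le hC a _ (norm_nonneg _) n fun i hi => abs_le_norm_sum_c0UnitBasis a hi

/-- A `1`-suppression unconditional sequence with biorthogonal functionals is basic. -/
theorem IsSuppressionSequence.isBasicSequence (hz : IsSuppressionSequence z)
    (f : ℕ → StrongDual ℝ X) (hf : ∀ i j, f i (z j) = if i = j then 1 else 0) :
    IsBasicSequence z := by
  let S : ℕ → X →L[ℝ] X := fun n => ∑ i ∈ Finset.range n, (f i).smulRight (z i)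
  have hS : ∀ n x, S n x = ∑ i ∈ Finset.range n, f i x • z i := fun n x => by
    simp [S]
  have hrep : ∀ x ∈ Submodule.span ℝ (Set.range z), ∃ (m : ℕ) (a : ℕ → ℝ),
      x = ∑ i ∈ Finset.range m, a i • z i := by
    intro x hx
    obtain ⟨c, rfl⟩ := Finsupp.mem_span_range_iff_exists_finsupp.1 hx
    obtain ⟨m, hm⟩ := c.support.exists_nat_subset_range
    exact ⟨m, c, Finsupp.sum_of_support_subset _ hm _ (by simp)⟩
  have hSrep : ∀ n m (a : ℕ → ℝ), S n (∑ i ∈ Finset.range m, a i • z i) =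
      ∑ i ∈ Finset.range (min n m), a i • z i := by
    intro n m a
    have hco : ∀ i, f i (∑ j ∈ Finset.range m, a j • z j) = if i < m then a i else 0 := by
      intro i; simp [map_sum, hf]
    rw [hS]
    simp only [hco, ite_smul, zero_smul]
    rw [← Finset.sum_filter]
    congr 1
    ext i; simp
  set V := (Submodule.span ℝ (Set.range z)).topologicalClosure with hV
  have hbound : ∀ n, ∀ x ∈ V, ‖S n x‖ ≤ ‖x‖ := by
    intro n x hx
    have hcl : IsClosed {x : X | ‖S n x‖ ≤ ‖x‖} :=
      isClosed_le (S n).continuous.norm continuous_norm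
    refine closure_minimal (fun y hy => ?_) hcl hx
    obtain ⟨m, a, rfl⟩ := hrep y hy
    change ‖S n _‖ ≤ _
    rw [hSrep]
    exact hz m a _ (Finset.range_subset_range.2 (min_le_right _ _))
  -- The `S n` are contractions on `V` and eventually fix each vector of the dense span.
  have hlim : ∀ x ∈ V, Tendsto (fun n => S n x) atTop (𝓝 x) := by
    intro x hx
    rw [Metric.tendsto_atTop]
    intro ε hε
    obtain ⟨y, hy, hxy⟩ := Metric.mem_closure_iff.1 (show x ∈ closure _ from hx) (ε / 2)
      (half_pos hε)
    obtain ⟨m, a, rfl⟩ := hrep y hy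
    refine ⟨m, fun n hn => ?_⟩
    have h1 := hbound n _ (V.sub_mem hx (Submodule.le_topologicalClosure _ hy))
    rw [map_sub, hSrep, min_eq_right hn] at h1
    rw [dist_eq_norm] at hxy ⊢
    have := norm_add_le (S n x - ∑ i ∈ Finset.range m, a i • z i)
      (-(x - ∑ i ∈ Finset.range m, a i • z i))
    rw [norm_neg] at this
    have he : S n x - x = S n x - ∑ i ∈ Finset.range m, a i • z i +
      -(x - ∑ i ∈ Finset.range m, a i • z i) := by abel
    rw [he]
    linarith
  have hmem : ∀ n, z n ∈ V := fun n =>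
    Submodule.le_topologicalClosure _ (Submodule.subset_span ⟨n, rfl⟩)
  refine ⟨{ basis := fun n => ⟨z n, hmem n⟩
            coord := fun n => (f n).comp V.subtypeL
            ortho := fun i j => by simp [hf, Pi.single_apply]
            expansion := fun x => ?_ }, fun n => rfl⟩
  rw [HasSum, SummationFilter.conditional_filter_eq_map_range, tendsto_map'_iff,
    tendsto_subtype_rng]
  refine (hlim x x.2).congr fun n => ?_
  simp [hS]

/-- A `1`-suppression unconditional sequence that is bounded away from zero, has bounded partial
sums and admits biorthogonal functionals has the `(N_1 1)` property. -/
theorem IsSuppressionSequence.seqHasNk1 [CompleteSpace X] (hz : IsSuppressionSequence z) {C η : ℝ}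
    (hC : ∀ n, ‖∑ i ∈ Finset.range n, z i‖ ≤ C) (hη0 : 0 < η) (hη : ∀ n, η ≤ ‖z n‖)
    (f : ℕ → StrongDual ℝ X) (hf : ∀ i j, f i (z j) = if i = j then 1 else 0) :
    SeqHasNk1 1 z := by
  have hC0 : 0 ≤ C := (norm_nonneg _).trans (hC 0)
  have hα : ∀ n : ℕ, (1 : ℝ) - 1 / (n + 1) ∈ Set.Ico (0 : ℝ) 1 := fun n => by
    have h1 : (0 : ℝ) < 1 / (n + 1) := by positivity
    have h2 : (1 : ℝ) / (n + 1) ≤ 1 := by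
      rw [div_le_one (by positivity)]; linarith [(Nat.cast_nonneg n : (0 : ℝ) ≤ n)]
    exact ⟨by linarith, by linarith⟩
  -- Any `α` in `[0, 1)` tending to 1 would do.
  refine ⟨⟨hz.isBasicSequence f hf, hz.equivalent_c0UnitBasis hC hη0 hη⟩,
    fun n => 1 - 1 / (n + 1), hα, ?_, fun a => ?_⟩
  · simpa using tendsto_const_nhds.sub (tendsto_one_div_add_atTop_nhds_zero_nat (𝕜 := ℝ))
  have hconv : ∀ b : ℕ → ℝ, Tendsto b atTop (𝓝 0) →
      ∃ v, Tendsto (fun n => ∑ i ∈ Finset.range n, b i • z i) atTop (𝓝 v) := by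
    intro b hb
    refine cauchySeq_tendsto_of_complete (Metric.cauchySeq_iff'.2 fun ε hε => ?_)
    have hδ : 0 < ε / (2 * C + 1) := by positivity
    obtain ⟨N, hN⟩ := Metric.tendsto_atTop.1 hb _ hδ
    refine ⟨N, fun n hn => ?_⟩
    -- Zeroing the coefficients below `N` turns the sup bound on the tail into a Cauchy estimate.
    have h := hz.norm_sum_le hC (fun i => if N ≤ i then b i else 0) _ hδ.le n fun i _ => by
      split_ifs with hi
      · simpa using (hN i hi).le
      · simpa using hδ.le
    have he : ∑ i ∈ Finset.range n, (if N ≤ i then b i else 0) • z i =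
        ∑ i ∈ Finset.range n, b i • z i - ∑ i ∈ Finset.range N, b i • z i := by
      rw [← Finset.sum_Ico_eq_sub _ hn]
      simp only [ite_smul, zero_smul]
      rw [← Finset.sum_filter]
      congr 1
      ext i; simp [and_comm]
    rw [he] at h
    rw [dist_eq_norm]
    refine h.trans_lt ?_
    rw [mul_div_assoc', div_lt_iff₀ (by positivity)]
    nlinarith
  have ha : Tendsto a atTop (𝓝 0) := by
    have := a.zero_at_infty'
    rwa [Filter.cocompact_eq_cofinite, Nat.cofinite_eq_atTop] at this
  have hαa : Tendsto (fun n : ℕ => (1 - 1 / ((n : ℝ) + 1)) * a n) atTop (𝓝 0) := by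
    refine squeeze_zero_norm (fun n => ?_) (by simpa using ha.norm)
    rw [norm_mul, Real.norm_of_nonneg (hα n).1]
    exact mul_le_of_le_one_left (norm_nonneg _) (hα n).2.le
  obtain ⟨u, hu⟩ := hconv _ hαa
  obtain ⟨v, hv⟩ := hconv _ ha
  refine ⟨u, v, ?_, ?_, ?_⟩
  · simp only [Nat.le_add_left, if_true]
    rwa [HasSum, SummationFilter.conditional_filter_eq_map_range, tendsto_map'_iff]
  · rwa [HasSum, SummationFilter.conditional_filter_eq_map_range, tendsto_map'_iff]
  · exact le_of_tendsto_of_tendsto' hu.norm hv.norm fun n =>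
      hz.norm_sum_mul_le _ a (fun i => ⟨(hα i).1, (hα i).2.le⟩) n

end SuppressionSequence

/-! ### Small weak neighbourhoods and PCP -/

section PointOfContinuity

variable {X : Type*} [NormedAddCommGroup X] [NormedSpace ℝ X]

/-- If every nonempty subset of `C` has, around one of its points, relatively weakly open subsets
of small diameter, then `C` has the point of continuity property. -/
theorem setHasPCP_of_forall_exists_nhds [CompleteSpace X] (C : Set X)
    (H : ∀ K ⊆ C, K.Nonempty → ∀ ε > 0, ∃ x ∈ K, ∃ W ∈ 𝓝 (toWeakSpace ℝ X x),
      ∀ y ∈ K, toWeakSpace ℝ X y ∈ W → ‖y - x‖ < ε) : SetHasPCP C := by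
  intro K hKC hK hKne
  have step : ∀ (n : ℕ) (W : {W : Set (WeakSpace ℝ X) //
      IsOpen W ∧ ∃ x ∈ K, toWeakSpace ℝ X x ∈ W}), ∃ W' : {W : Set (WeakSpace ℝ X) //
      IsOpen W ∧ ∃ x ∈ K, toWeakSpace ℝ X x ∈ W}, closure W'.1 ⊆ W.1 ∧
      ∀ y ∈ K, ∀ y' ∈ K, toWeakSpace ℝ X y ∈ W'.1 → toWeakSpace ℝ X y' ∈ W'.1 →
        dist y y' < (1 / 2 : ℝ) ^ n := by
    rintro n ⟨W, hWo, x₀, hx₀, hx₀W⟩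
    -- The slice of `K` by `W` need not be closed, which is why `H` ranges over all subsets of `C`.
    obtain ⟨x, ⟨hxK, hxW⟩, U, hU, hy⟩ := H {y ∈ K | toWeakSpace ℝ X y ∈ W}
      (fun y hy => hKC hy.1) ⟨x₀, hx₀, hx₀W⟩ ((1 / 2 : ℝ) ^ n / 2) (by positivity)
    obtain ⟨T, hT, hTc, hTs⟩ := exists_mem_nhds_isClosed_subset
      (inter_mem hU (hWo.mem_nhds hxW))
    have hcl : closure (interior T) ⊆ U ∩ W :=
      (closure_minimal interior_subset hTc).trans hTs
    refine ⟨⟨interior T, isOpen_interior, x, hxK, mem_interior_iff_mem_nhds.2 hT⟩,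
      hcl.trans Set.inter_subset_right, fun y hyK y' hyK' hyT hyT' => ?_⟩
    have h1 := hcl (subset_closure hyT)
    have h2 := hcl (subset_closure hyT')
    have h3 := hy y ⟨hyK, h1.2⟩ h1.1
    have h4 := hy y' ⟨hyK', h2.2⟩ h2.1
    rw [← dist_eq_norm] at h3 h4
    linarith [dist_triangle_right y y' x]
  choose g hg using step
  let W : ℕ → {W : Set (WeakSpace ℝ X) // IsOpen W ∧ ∃ x ∈ K, toWeakSpace ℝ X x ∈ W} :=
    fun n => Nat.rec ⟨Set.univ, isOpen_univ, hKne.some, hKne.some_mem, Set.mem_univ _⟩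
      (fun n V => g n V) n
  have hcl : ∀ n, closure (W (n + 1)).1 ⊆ (W n).1 := fun n => (hg n (W n)).1
  have hdist : ∀ n, ∀ y ∈ K, ∀ y' ∈ K, toWeakSpace ℝ X y ∈ (W (n + 1)).1 →
      toWeakSpace ℝ X y' ∈ (W (n + 1)).1 → dist y y' < (1 / 2 : ℝ) ^ n :=
    fun n => (hg n (W n)).2
  have hanti : Antitone fun n => (W n).1 :=
    antitone_nat_of_succ_le fun n => subset_closure.trans (hcl n)
  choose p hpK hpW using fun n => (W n).2.2
  have hsmall : ∀ ε > 0, ∃ n : ℕ, (1 / 2 : ℝ) ^ n < ε := fun ε hε =>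
    exists_pow_lt_of_lt_one hε (by norm_num)
  have hcau : CauchySeq p := by
    refine Metric.cauchySeq_iff'.2 fun ε hε => ?_
    obtain ⟨n, hn⟩ := hsmall ε hε
    exact ⟨n + 1, fun m hm => (hdist n _ (hpK m) _ (hpK _) (hanti hm (hpW m)) (hpW (n + 1))).trans hn⟩
  obtain ⟨x, hx⟩ := cauchySeq_tendsto_of_complete hcau
  -- The nested closures keep the norm limit `x` inside every `W n`, so these sets are weak
  -- neighbourhoods of `x` with small traces on `K`.
  have hxK : x ∈ K := hK.mem_of_tendsto hx (Eventually.of_forall hpK)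
  have hxW : ∀ n, toWeakSpace ℝ X x ∈ (W n).1 := fun n => hcl n <| by
    have hxw : Tendsto (fun m => toWeakSpace ℝ X (p m)) atTop (𝓝 (toWeakSpace ℝ X x)) :=
      ((toWeakSpaceCLM ℝ X).continuous.tendsto x).comp hx
    exact mem_closure_of_tendsto hxw
      (eventually_atTop.2 ⟨n + 1, fun m hm => hanti hm (hpW m)⟩)
  refine ⟨x, hxK, Metric.tendsto_nhds.2 fun ε hε => ?_⟩
  obtain ⟨n, hn⟩ := hsmall ε hε
  filter_upwards [mem_nhdsWithin_of_mem_nhds ((W (n + 1)).2.1.mem_nhds (hxW (n + 1))),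
    self_mem_nhdsWithin] with y hyW hyK
  obtain ⟨y, hyK, rfl⟩ := hyK
  simpa using (hdist n y hyK x hxK hyW (hxW (n + 1))).trans hn

end PointOfContinuity

/-! ### Block sequences of the basis -/

section Blocks

variable {X : Type*} [NormedAddCommGroup X] [NormedSpace ℝ X] (e : SchauderBasis ℝ X)

theorem IsSuppressionUnconditional.norm_proj_le {e : SchauderBasis ℝ X}
    (he : IsSuppressionUnconditional 1 e) (A : Finset ℕ) (x : X) :
    ‖GeneralSchauderBasis.proj e A x‖ ≤ ‖x‖ := by
  refine ge_of_tendsto (SchauderBasis.tendsto_proj e x).norm ?_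
  obtain ⟨m, hm⟩ := A.exists_nat_subset_range
  filter_upwards [eventually_ge_atTop m] with n hn
  simpa using he n (fun i => e.coord i x) A (hm.trans (Finset.range_subset_range.2 hn))

/-- Vectors supported in consecutive blocks of a `1`-suppression unconditional basis form a
`1`-suppression unconditional sequence. -/
theorem IsSuppressionUnconditional.isSuppressionSequence {e : SchauderBasis ℝ X}
    (he : IsSuppressionUnconditional 1 e) {N : ℕ → ℕ} (hN : Monotone N) (d : ℕ → X) :
    IsSuppressionSequence fun n =>
      GeneralSchauderBasis.proj e (Finset.Ico (N n) (N (n + 1))) (d n) := by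
  have hcomp : ∀ A B x, GeneralSchauderBasis.proj e A (GeneralSchauderBasis.proj e B x) =
      GeneralSchauderBasis.proj e (A ∩ B) x := fun A B x => by
    rw [GeneralSchauderBasis.proj_comp]
    congr!
  intro n c F hF
  -- Keeping the terms in `F` is the basis projection onto the union of their blocks.
  refine le_trans (le_of_eq ?_) (he.norm_proj_le
    (F.biUnion fun j => Finset.Ico (N j) (N (j + 1))) _)
  rw [map_sum, ← Finset.sum_subset hF]
  · refine congrArg norm (Finset.sum_congr rfl fun j hj => ?_)
    rw [map_smul, hcomp, Finset.inter_eq_right.2 (Finset.subset_biUnion_of_mem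
      (fun j => Finset.Ico (N j) (N (j + 1))) hj)]
  · intro j _ hj
    rw [map_smul, hcomp]
    have : (F.biUnion fun j => Finset.Ico (N j) (N (j + 1))) ∩
        Finset.Ico (N j) (N (j + 1)) = ∅ := by
      rw [← Finset.disjoint_iff_inter_eq_empty, Finset.disjoint_biUnion_left]
      intro i hi
      have hij : i ≠ j := fun h => hj (h ▸ hi)
      rw [← Finset.disjoint_coe, Finset.coe_Ico, Finset.coe_Ico]
      exact hN.pairwise_disjoint_on_Ico_succ hij
    rw [this]
    simp

/-- Nonzero vectors supported in consecutive blocks of a Schauder basis admit biorthogonal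
functionals. -/
theorem exists_biorthogonal_of_blocks {N : ℕ → ℕ} (hN : Monotone N) (d : ℕ → X)
    (h0 : ∀ n, GeneralSchauderBasis.proj e (Finset.Ico (N n) (N (n + 1))) (d n) ≠ 0) :
    ∃ f : ℕ → StrongDual ℝ X, ∀ i j, f i (GeneralSchauderBasis.proj e
      (Finset.Ico (N j) (N (j + 1))) (d j)) = if i = j then 1 else 0 := by
  have hco : ∀ k j, e.coord k (GeneralSchauderBasis.proj e (Finset.Ico (N j) (N (j + 1))) (d j)) =
      if k ∈ Finset.Ico (N j) (N (j + 1)) then e.coord k (d j) else 0 := fun k j => by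
    rw [GeneralSchauderBasis.proj_apply]
    simp [map_sum, e.ortho, Pi.single_apply, -Finset.mem_Ico]
  -- One nonvanishing coordinate per block, normalised, serves as the functional: it kills all other
  -- blocks.
  have hex : ∀ n, ∃ k ∈ Finset.Ico (N n) (N (n + 1)), e.coord k (d n) ≠ 0 := by
    intro n
    by_contra! h
    refine h0 n ?_
    rw [GeneralSchauderBasis.proj_apply]
    exact Finset.sum_eq_zero fun i hi => by rw [h i hi, zero_smul]
  choose k hk hk0 using hex
  refine ⟨fun n => (e.coord (k n) (d n))⁻¹ • e.coord (k n), fun i j => ?_⟩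
  rw [_root_.smul_apply, hco, smul_eq_mul]
  rcases eq_or_ne i j with rfl | hij
  · rw [if_pos (hk i), if_pos rfl, inv_mul_cancel₀ (hk0 i)]
  · have hdis := hN.pairwise_disjoint_on_Ico_succ hij
    rw [if_neg, if_neg hij, mul_zero]
    intro h
    refine Set.disjoint_left.1 hdis ?_ (Finset.mem_Ico.1 h)
    exact Finset.mem_Ico.1 (hk i)

theorem continuous_proj_weakSpace (n : ℕ) :
    Continuous fun y : WeakSpace ℝ X => e.proj n ((toWeakSpace ℝ X).symm y) := by
  simp only [SchauderBasis.proj_apply]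
  refine continuous_finsetSum _ fun i _ => Continuous.smul ?_ continuous_const
  exact WeakBilin.eval_continuous (topDualPairing ℝ X).flip (e.coord i)

/-- If no weak neighbourhood of a point of the bounded set `K` is small on `K`, then a
`1`-suppression unconditional basis has a block sequence with the `(N_1 1)` property. -/
theorem IsSuppressionUnconditional.spaceHasNk1 [CompleteSpace X] {e : SchauderBasis ℝ X}
    (he : IsSuppressionUnconditional 1 e) {K : Set X} (hKb : K ⊆ Metric.closedBall 0 1)
    (hKne : K.Nonempty) {ε : ℝ} (hε : 0 < ε)
    (H : ∀ x ∈ K, ∀ W ∈ 𝓝 (toWeakSpace ℝ X x), ∃ y ∈ K, toWeakSpace ℝ X y ∈ W ∧ ε ≤ ‖y - x‖) :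
    SpaceHasNk1 X := by
  have step : ∀ (n : ℕ) (s : K × ℕ), ∃ t : K × ℕ, s.2 ≤ t.2 ∧ ε ≤ ‖(t.1 : X) - s.1‖ ∧
      ‖GeneralSchauderBasis.proj e (Finset.Ico s.2 t.2) ((t.1 : X) - s.1) - ((t.1 : X) - s.1)‖ ≤
        ε / 4 * (1 / 2) ^ n := by
    rintro n ⟨⟨x, hx⟩, N⟩
    -- These errors sum to at most `ε / 2`, and each is at most `ε / 4`, which leaves `‖z n‖ ≥ ε /
    -- 2`. Half of `δ` pays for the head below `N`, half for the tail beyond the block.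
    set δ := ε / 4 * (1 / 2 : ℝ) ^ n with hδ
    have hδ0 : 0 < δ := by positivity
    obtain ⟨y, hy, hyW, hyx⟩ := H x hx _
      ((continuous_proj_weakSpace e N).continuousAt.preimage_mem_nhds (Metric.ball_mem_nhds _ (half_pos hδ0)))
    have hyW' : ‖e.proj N y - e.proj N x‖ < δ / 2 := by
      simpa only [Set.mem_preimage, Metric.mem_ball, dist_eq_norm,
        LinearEquiv.symm_apply_apply] using hyW
    obtain ⟨M, hM⟩ := Metric.tendsto_atTop.1 (SchauderBasis.tendsto_proj e (y - x)) _
      (half_pos hδ0)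
    have hM' := hM (max M N) (le_max_left _ _)
    refine ⟨⟨⟨y, hy⟩, max M N⟩, le_max_right _ _, hyx, ?_⟩
    have hsplit : GeneralSchauderBasis.proj e (Finset.Ico N (max M N)) (y - x) =
        e.proj (max M N) (y - x) - e.proj N (y - x) := by
      rw [GeneralSchauderBasis.proj_apply, SchauderBasis.proj_apply, SchauderBasis.proj_apply,
        Finset.sum_Ico_eq_sub _ (le_max_right M N)]
    change ‖GeneralSchauderBasis.proj e (Finset.Ico N (max M N)) (y - x) - (y - x)‖ ≤ δ
    rw [hsplit, sub_right_comm]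
    rw [← map_sub] at hyW'
    rw [dist_eq_norm] at hM'
    exact (norm_sub_le _ _).trans (by linarith)
  choose g hg1 hg2 hg3 using step
  let s : ℕ → K × ℕ := fun n => Nat.rec (⟨hKne.some, hKne.some_mem⟩, 0) (fun n t => g n t) n
  let d : ℕ → X := fun n => ((s (n + 1)).1 : X) - (s n).1
  let N : ℕ → ℕ := fun n => (s n).2
  have hN : Monotone N := monotone_nat_of_le_succ fun n => hg1 n (s n)
  have hd : ∀ n, ε ≤ ‖d n‖ := fun n => hg2 n (s n)
  let z : ℕ → X := fun n => GeneralSchauderBasis.proj e (Finset.Ico (N n) (N (n + 1))) (d n)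
  have hzd : ∀ n, ‖z n - d n‖ ≤ ε / 4 * (1 / 2) ^ n := fun n => hg3 n (s n)
  have hη : ∀ n, ε / 2 ≤ ‖z n‖ := fun n => by
    have h1 : (1 / 2 : ℝ) ^ n ≤ 1 := pow_le_one₀ (by norm_num) (by norm_num)
    have h2 : ‖d n‖ - ‖z n‖ ≤ ‖d n - z n‖ := norm_sub_norm_le _ _
    rw [norm_sub_rev (d n) (z n)] at h2
    nlinarith [hd n, hzd n]
  have hC : ∀ n, ‖∑ i ∈ Finset.range n, z i‖ ≤ 2 + ε / 2 := fun n => by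
    have h1 : ‖∑ i ∈ Finset.range n, d i‖ ≤ 2 := by
      have : ∑ i ∈ Finset.range n, d i = ((s n).1 : X) - (s 0).1 :=
        Finset.sum_range_sub (fun i => ((s i).1 : X)) n
      rw [this]
      have ha := mem_closedBall_zero_iff.1 (hKb (s n).1.2)
      have hb := mem_closedBall_zero_iff.1 (hKb (s 0).1.2)
      exact (norm_sub_le _ _).trans (by linarith)
    have h2 : ‖∑ i ∈ Finset.range n, (z i - d i)‖ ≤ ε / 2 := by
      refine (norm_sum_le_of_le _ fun i _ => hzd i).trans ?_
      rw [← Finset.mul_sum]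
      have := sum_geometric_two_le n
      nlinarith
    have h3 : ∑ i ∈ Finset.range n, z i =
        ∑ i ∈ Finset.range n, d i + ∑ i ∈ Finset.range n, (z i - d i) := by
      rw [← Finset.sum_add_distrib]
      exact Finset.sum_congr rfl fun i _ => (add_sub_cancel (d i) (z i)).symm
    rw [h3]
    exact (norm_add_le _ _).trans (add_le_add h1 h2)
  obtain ⟨f, hf⟩ := exists_biorthogonal_of_blocks e hN d fun n h => by
    have := hη n
    rw [show z n = 0 from h, norm_zero] at this
    linarith
  exact ⟨1, le_rfl, z, (he.isSuppressionSequence hN d).seqHasNk1 hC (half_pos hε) hη f hf⟩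

end Blocks

theorem mainTheorem2 {X : Type*} [NormedAddCommGroup X] [NormedSpace ℝ X] [CompleteSpace X]
    (e : SchauderBasis ℝ X) (he : IsSuppressionUnconditional 1 e) (hN : ¬ SpaceHasNk1 X) :
    SpaceHasPCP X := by
  refine setHasPCP_of_forall_exists_nhds _ fun K hKb hKne ε hε => ?_
  by_contra! h
  exact hN (he.spaceHasNk1 hKb hKne hε h)
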